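/- Let $\gamma$ be a germ at $t_0$ of a smooth ($C^\infty$, regular) strictly convex curve in the plane, represented by $\gamma\colon I\to\mathbb{R}^2$ on an open interval $I\ni t_0$; strictly convex means that for every $s\in I$ all the points $\gamma(t)$, $t\in I\setminus\{s\}$, lie strictly on one side of the tangent line to $\gamma$ at $\gamma(s)$. A point $A$ lies on the concave side of $\gamma$ if, for some $s\in I$, the tangent line at $\gamma(s)$ strictly separates $A$ from all the points $\gamma(t)$, $t\in I\setminus\{s\}$. If such a point $A$ lies on the tangent lines to $\gamma$ at two distinct points $\gamma(s)$ and $\gamma(t)$, $s,t\in I$, then the line $a$ through $\gamma(s)$ and $\gamma(t)$ is called dual to $A$. Assume that there is a neighborhood $U$ of $\gamma(t_0)$ such that, for all points $A,B\in U$ on the concave side of $\gamma$ that have dual lines $a$ and $b$, if $B$ lies on $a$ then $A$ lies on $b$. Then $\gamma$ is an arc of a conic: there is a non-degenerate conic that contains $\gamma(t)$ for all $t$ sufficiently close to $t_0$. -/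

import Mathlib

open Set Topology
open scoped ContDiff Matrix

/-- The Euclidean plane. -/
abbrev Plane : Type := EuclideanSpace ℝ (Fin 2)

/-- The determinant of the pair of plane vectors `u, v`. -/
def planeDet (u v : Plane) : ℝ := u 0 * v 1 - u 1 * v 0

/-- `γ` restricted to the open set of parameters `I` is a smooth regular curve that is strictly
convex: for each `s` in `I`, the rest of the curve lies strictly on one side of the tangent line
at `γ s`. -/
structure IsSmoothConvexArc (γ : ℝ → Plane) (I : Set ℝ) : Prop where
  smooth : ContDiffOn ℝ ∞ γ I
  regular : ∀ t ∈ I, deriv γ t ≠ 0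
  convex : ∀ s ∈ I,
    (∀ t ∈ I, t ≠ s → 0 < planeDet (deriv γ s) (γ t - γ s)) ∨
    (∀ t ∈ I, t ≠ s → planeDet (deriv γ s) (γ t - γ s) < 0)

/-- The tangent line of `γ` at the point `γ t`. -/
noncomputable def tangentLine (γ : ℝ → Plane) (t : ℝ) : AffineSubspace ℝ Plane :=
  AffineSubspace.mk' (γ t) (Submodule.span ℝ {deriv γ t})

/-- `A` lies on the concave side of the arc `γ|I`: some tangent line strictly separates `A` from
the arc (apart from the point of tangency). -/
def OnConcaveSide (γ : ℝ → Plane) (I : Set ℝ) (A : Plane) : Prop :=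
  ∃ s ∈ I, ∀ t ∈ I, t ≠ s →
    planeDet (deriv γ s) (A - γ s) * planeDet (deriv γ s) (γ t - γ s) < 0

/-- The line `a` is dual to the point `A`: `A` lies on the concave side of the arc, and `a` is the
line through the two points at which the tangent lines drawn from `A` touch the arc. -/
def IsDualLine (γ : ℝ → Plane) (I : Set ℝ) (A : Plane) (a : AffineSubspace ℝ Plane) : Prop :=
  OnConcaveSide γ I A ∧
    ∃ s ∈ I, ∃ t ∈ I, s ≠ t ∧ A ∈ tangentLine γ s ∧ A ∈ tangentLine γ t ∧
      a = line[ℝ, γ s, γ t]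

/-- The duality preserves incidence for points of `U`: whenever `A, B` in `U` have dual lines
`a, b` and `B` is on `a`, then `A` is on `b`. -/
def DualityPreservesIncidence (γ : ℝ → Plane) (I : Set ℝ) (U : Set Plane) : Prop :=
  ∀ A ∈ U, ∀ B ∈ U, ∀ a b : AffineSubspace ℝ Plane,
    IsDualLine γ I A a → IsDualLine γ I B b → B ∈ a → A ∈ b

/-- `C` is a non-degenerate conic: the zero set in the plane of a quadratic polynomial whose
symmetric `3 × 3` coefficient matrix is invertible. -/
def IsConic (C : Set Plane) : Prop :=
  ∃ M : Matrix (Fin 3) (Fin 3) ℝ, M.IsSymm ∧ M.det ≠ 0 ∧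
    C = {P : Plane | ![P 0, P 1, 1] ⬝ᵥ (M *ᵥ ![P 0, P 1, 1]) = 0}

/-!
The duality hypothesis is used in the limit in which the point `B` on the line `a` tends to one of
the two points of tangency. Fix a parameter `s` slightly before `t₀` at which the curvature is
nonzero (`exists_planeDet_deriv_ne_zero`: it cannot vanish on an interval, by strict convexity), and
affine coordinates `(x, y)` with origin `γ s` whose first axis is the tangent line there. For
`t > s` let `(X, Y) = γ t`, let `A = (u, 0)` be the intersection point of the tangent lines at `γ s`
and `γ t`, and let `B = -ε • (X, Y)`. The tangent lines from `B` touch the arc at parameters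
`p < s < q` that tend to `s` with `ε`, and by hypothesis `A`, `γ p` and `γ q` are collinear
(`exists_tangents_near`). So two functions with a nondegenerate critical point at `s`, one
expressing that the tangent lines at `p` and `q` meet on the line `a`, the other that `A`, `γ p`,
`γ q` are collinear, take equal values at the same pairs `p`, `q`. Comparison of their third
derivatives (`third_order_contact_relation`) gives `c * X / Y + k = m / u` with constants `c ≠ 0`,
`k`, `m ≠ 0` that depend on the germ at `s` only.

Since `u` is determined by `(X, Y)` and the tangent direction there, this is a first-order
differential equation for the arc `t ↦ (X, Y)`. In the projective coordinates `ξ = X / Y`,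
`η = 1 / Y` it reads `(c * ξ + k) * ξ' = m * η'`, hence `c * ξ ^ 2 / 2 + k * ξ - m * η` is constant
(`exists_quadratic_relation`). This is the equation of a conic, which is non-degenerate because
`c * m ≠ 0` (`isConic_of_quadratic`). It holds for all `t > s`, in particular in a neighbourhood of
`t₀`, whether or not the curvature vanishes at `t₀`.

Throughout, `σ` is the common sign of strict convexity, and `w` is a vector such that the coordinate
`planeDet w` increases along the part `J` of the arc that is considered.
-/

open Filter

/-! ### Third-order comparison at a critical point -/

/-- Third-order Taylor expansion at a zero of order three. -/
theorem tendsto_div_cube_of_hasDerivAt {S S₁ S₂ : ℝ → ℝ} {s S₃ : ℝ}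
    (h : ∀ᶠ τ in 𝓝 s, HasDerivAt S (S₁ τ) τ) (h₁ : ∀ᶠ τ in 𝓝 s, HasDerivAt S₁ (S₂ τ) τ)
    (h₂ : HasDerivAt S₂ S₃ s) (e : S s = 0) (e₁ : S₁ s = 0) (e₂ : S₂ s = 0) :
    Tendsto (fun τ => S τ / (τ - s) ^ 3) (𝓝[≠] s) (𝓝 (S₃ / 6)) := by
  have hne : ∀ᶠ τ in 𝓝[≠] s, τ - s ≠ 0 := by
    filter_upwards [self_mem_nhdsWithin] with τ hτ using sub_ne_zero.2 hτ
  have hz : ∀ n : ℕ, n ≠ 0 → ∀ c : ℝ,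
      Tendsto (fun τ : ℝ => c * (τ - s) ^ n) (𝓝[≠] s) (𝓝 0) := by
    intro n hn c
    have : Continuous fun τ : ℝ => c * (τ - s) ^ n := by fun_prop
    simpa [hn] using (this.tendsto s).mono_left nhdsWithin_le_nhds
  have hd : ∀ n : ℕ, ∀ c τ : ℝ,
      HasDerivAt (fun τ : ℝ => c * (τ - s) ^ n) (c * (n * (τ - s) ^ (n - 1))) τ := by
    intro n c τ
    simpa using (((hasDerivAt_id τ).sub_const s).pow n).const_mul c
  have hS : Tendsto S (𝓝[≠] s) (𝓝 0) := by
    simpa [e] using h.self_of_nhds.continuousAt.tendsto.mono_left nhdsWithin_le_nhds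
  have hS₁ : Tendsto S₁ (𝓝[≠] s) (𝓝 0) := by
    simpa [e₁] using h₁.self_of_nhds.continuousAt.tendsto.mono_left nhdsWithin_le_nhds
  have l₂ : Tendsto (fun τ => S₂ τ / (6 * (τ - s) ^ 1)) (𝓝[≠] s) (𝓝 (S₃ / 6)) := by
    refine (h₂.tendsto_slope.div_const 6).congr' ?_
    filter_upwards [hne] with τ hτ
    rw [slope_def_field, e₂]
    field_simp
    ring
  have l₁ : Tendsto (fun τ => S₁ τ / (3 * (τ - s) ^ 2)) (𝓝[≠] s) (𝓝 (S₃ / 6)) := by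
    refine HasDerivAt.lhopital_zero_nhdsNE (h₁.filter_mono nhdsWithin_le_nhds)
      (Eventually.of_forall (hd 2 3)) ?_ hS₁ (hz 2 two_ne_zero 3) ?_
    · filter_upwards [hne] with τ hτ
      simpa using hτ
    · refine l₂.congr fun τ => ?_
      norm_num
      ring_nf
  have l₀ : Tendsto (fun τ => S τ / (1 * (τ - s) ^ 3)) (𝓝[≠] s) (𝓝 (S₃ / 6)) := by
    refine HasDerivAt.lhopital_zero_nhdsNE (h.filter_mono nhdsWithin_le_nhds)
      (Eventually.of_forall (hd 3 1)) ?_ hS (hz 3 three_ne_zero 1) ?_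
    · filter_upwards [hne] with τ hτ
      simpa using hτ
    · refine l₁.congr fun τ => ?_
      norm_num
  simpa using l₀

/-- If `S` vanishes to second order at `s`, but the quotient `S / N` takes equal values at pairs of
points on either side of `s` and arbitrarily close to it, then the third derivative of `S` is zero:
otherwise `S / N` would have opposite signs on the two sides. -/
theorem third_deriv_eq_zero_of_pairs {S S₁ S₂ N : ℝ → ℝ} {s S₃ : ℝ}
    (h : ∀ᶠ τ in 𝓝 s, HasDerivAt S (S₁ τ) τ) (h₁ : ∀ᶠ τ in 𝓝 s, HasDerivAt S₁ (S₂ τ) τ)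
    (h₂ : HasDerivAt S₂ S₃ s) (e : S s = 0) (e₁ : S₁ s = 0) (e₂ : S₂ s = 0)
    (hN : ContinuousAt N s) (hN₀ : N s ≠ 0)
    (hpq : ∀ δ > 0, ∃ p ∈ Ioo (s - δ) s, ∃ q ∈ Ioo s (s + δ), S p * N q = S q * N p) :
    S₃ = 0 := by
  by_contra hS₃
  have hlim := (tendsto_div_cube_of_hasDerivAt h h₁ h₂ e e₁ e₂).mul
    (hN.tendsto.mono_left (nhdsWithin_le_nhds (s := {s}ᶜ)))
  have hpos := (hlim.const_mul (S₃ / 6 * N s)).eventually_const_lt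
    (show (0 : ℝ) < S₃ / 6 * N s * (S₃ / 6 * N s) from
      mul_self_pos.2 (mul_ne_zero (div_ne_zero hS₃ (by norm_num)) hN₀))
  obtain ⟨δ, hδ, hball⟩ := Metric.mem_nhdsWithin_iff.1 hpos
  obtain ⟨p, hp, q, hq, hSN⟩ := hpq δ hδ
  have key : ∀ τ, τ ≠ s → |τ - s| < δ →
      0 < S₃ / 6 * N s * (S τ / (τ - s) ^ 3 * N τ) := fun τ hne hτ =>
    hball ⟨by simpa [Real.dist_eq] using hτ, hne⟩
  have kp := key p hp.2.ne (by rw [abs_lt]; constructor <;> linarith [hp.1, hp.2])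
  have kq := key q hq.1.ne' (by rw [abs_lt]; constructor <;> linarith [hq.1, hq.2])
  have cp : (p - s) ^ 3 < 0 := by
    have : p - s < 0 := by linarith [hp.2]
    exact Odd.pow_neg (by decide) this
  have cq : 0 < (q - s) ^ 3 := pow_pos (by linarith [hq.1]) 3
  set c := S₃ / 6 * N s
  have cancel : ∀ c a b n : ℝ, b ≠ 0 → c * (a / b * n) * b = c * (a * n) := by
    intro c a b n hb
    field_simp
  have kp' : c * (S p * N p) < 0 := by
    have := mul_neg_of_pos_of_neg kp cp
    rwa [cancel _ _ _ _ cp.ne] at this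
  have kq' : 0 < c * (S q * N q) := by
    have := mul_pos kq cq
    rwa [cancel _ _ _ _ cq.ne'] at this
  have hsq : c * (S p * N p) * (N q) ^ 2 = c * (S q * N q) * (N p) ^ 2 := by
    linear_combination c * N p * N q * hSN
  have hNq : N q ≠ 0 := by
    rintro h0
    simp [h0] at kq'
  have hq2 : 0 < N q ^ 2 := by positivity
  nlinarith [mul_neg_of_neg_of_pos kp' hq2, mul_nonneg kq'.le (sq_nonneg (N p))]

/-- Let `(x, y)` be a curve that passes at `s` through the origin, tangent to the first axis, with
nonzero curvature, and write `V = x₁ * Y - y₁ * X`, `W = x * y₁ - x₁ * y`. Equality of `W / V` at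
`p` and `q` means that the tangent lines at `p` and `q` meet the line through the origin and
`(X, Y)` in the same point; equality of `y / (u - x)` means that `p` and `q` are collinear with
`(u, 0)`. Both functions have a nondegenerate critical point at `s`, with value zero, so if they are
equal at common pairs `p < s < q` close to `s`, the ratios of their third to their second
derivatives at `s` agree. This is the stated relation. -/
theorem third_order_contact_relation {x x₁ x₂ x₃ y y₁ y₂ y₃ : ℝ → ℝ} {s x₄ y₄ X Y u : ℝ}
    (hx : ∀ᶠ τ in 𝓝 s, HasDerivAt x (x₁ τ) τ) (hx₁ : ∀ᶠ τ in 𝓝 s, HasDerivAt x₁ (x₂ τ) τ)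
    (hx₂ : ∀ᶠ τ in 𝓝 s, HasDerivAt x₂ (x₃ τ) τ) (hx₃ : HasDerivAt x₃ x₄ s)
    (hy : ∀ᶠ τ in 𝓝 s, HasDerivAt y (y₁ τ) τ) (hy₁ : ∀ᶠ τ in 𝓝 s, HasDerivAt y₁ (y₂ τ) τ)
    (hy₂ : ∀ᶠ τ in 𝓝 s, HasDerivAt y₂ (y₃ τ) τ) (hy₃ : HasDerivAt y₃ y₄ s)
    (ex : x s = 0) (ey : y s = 0) (ey₁ : y₁ s = 0) (ex₁ : x₁ s ≠ 0) (ey₂ : y₂ s ≠ 0)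
    (hY : Y ≠ 0) (hu : u ≠ 0)
    (hpq : ∀ δ > 0, ∃ p ∈ Ioo (s - δ) s, ∃ q ∈ Ioo s (s + δ),
      (x p * y₁ p - x₁ p * y p) * (x₁ q * Y - y₁ q * X) =
        (x q * y₁ q - x₁ q * y q) * (x₁ p * Y - y₁ p * X) ∧
      y p * (u - x q) = y q * (u - x p)) :
    y₂ s * (X / Y) + (y₃ s / y₂ s - 3 * (x₂ s / x₁ s)) * x₁ s / 3 = x₁ s ^ 2 / u := by
  -- `κ` makes the second-order terms of `y / (u - x)` and `κ * W / V` agree.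
  set κ : ℝ := Y / u with hκ
  let V : ℝ → ℝ := fun τ => x₁ τ * Y - y₁ τ * X
  let W : ℝ → ℝ := fun τ => x τ * y₁ τ - x₁ τ * y τ
  have hV : ∀ᶠ τ in 𝓝 s, HasDerivAt V (x₂ τ * Y - y₂ τ * X) τ := by
    filter_upwards [hx₁, hy₁] with τ a b using (a.mul_const Y).sub (b.mul_const X)
  have hV₁ : ∀ᶠ τ in 𝓝 s, HasDerivAt (fun τ => x₂ τ * Y - y₂ τ * X) (x₃ τ * Y - y₃ τ * X) τ := by
    filter_upwards [hx₂, hy₂] with τ a b using (a.mul_const Y).sub (b.mul_const X)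
  have hV₂ : HasDerivAt (fun τ => x₃ τ * Y - y₃ τ * X) (x₄ * Y - y₄ * X) s :=
    (hx₃.mul_const Y).sub (hy₃.mul_const X)
  have hW : ∀ᶠ τ in 𝓝 s, HasDerivAt W (x τ * y₂ τ - x₂ τ * y τ) τ := by
    filter_upwards [hx, hx₁, hy, hy₁] with τ a b c d
    exact ((a.mul d).sub (b.mul c)).congr_deriv (by ring)
  have hW₁ : ∀ᶠ τ in 𝓝 s, HasDerivAt (fun τ => x τ * y₂ τ - x₂ τ * y τ)
      (x₁ τ * y₂ τ - x₂ τ * y₁ τ + x τ * y₃ τ - x₃ τ * y τ) τ := by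
    filter_upwards [hx, hx₂, hy, hy₂] with τ a b c d
    exact ((a.mul d).sub (b.mul c)).congr_deriv (by ring)
  have hW₂ : HasDerivAt (fun τ => x₁ τ * y₂ τ - x₂ τ * y₁ τ + x τ * y₃ τ - x₃ τ * y τ)
      (2 * x₁ s * y₃ s) s :=
    ((((hx₁.self_of_nhds.mul hy₂.self_of_nhds).sub (hx₂.self_of_nhds.mul hy₁.self_of_nhds)).add
      (hx.self_of_nhds.mul hy₃)).sub (hx₃.mul hy.self_of_nhds)).congr_deriv
        (by rw [ex, ey, ey₁]; ring)
  have hS : ∀ᶠ τ in 𝓝 s, HasDerivAt (fun τ => y τ * V τ - κ * (W τ * (u - x τ)))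
      (y₁ τ * V τ + y τ * (x₂ τ * Y - y₂ τ * X) -
        κ * ((x τ * y₂ τ - x₂ τ * y τ) * (u - x τ) - W τ * x₁ τ)) τ := by
    filter_upwards [hx, hy, hV, hW] with τ a b c d
    exact ((b.mul c).sub ((d.mul (a.const_sub u)).const_mul κ)).congr_deriv (by ring)
  have hS₁ : ∀ᶠ τ in 𝓝 s, HasDerivAt (fun τ => y₁ τ * V τ + y τ * (x₂ τ * Y - y₂ τ * X) -
        κ * ((x τ * y₂ τ - x₂ τ * y τ) * (u - x τ) - W τ * x₁ τ))
      (y₂ τ * V τ + 2 * (y₁ τ * (x₂ τ * Y - y₂ τ * X)) + y τ * (x₃ τ * Y - y₃ τ * X) -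
        κ * ((x₁ τ * y₂ τ - x₂ τ * y₁ τ + x τ * y₃ τ - x₃ τ * y τ) * (u - x τ) -
          2 * ((x τ * y₂ τ - x₂ τ * y τ) * x₁ τ) - W τ * x₂ τ)) τ := by
    filter_upwards [hx, hx₁, hy, hy₁, hV, hV₁, hW, hW₁] with τ a a₁ b b₁ c c₁ d d₁
    exact (((b₁.mul c).add (b.mul c₁)).sub
      (((d₁.mul (a.const_sub u)).sub (d.mul a₁)).const_mul κ)).congr_deriv (by ring)
  have hS₂ := ((((hy₂.self_of_nhds.mul hV.self_of_nhds).add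
    ((hy₁.self_of_nhds.mul hV₁.self_of_nhds).const_mul 2)).add (hy.self_of_nhds.mul hV₂)).sub
      ((((hW₂.mul (hx.self_of_nhds.const_sub u)).sub
        ((hW₁.self_of_nhds.mul hx₁.self_of_nhds).const_mul 2)).sub
          (hW.self_of_nhds.mul hx₂.self_of_nhds)).const_mul κ))
  have hVc : ContinuousAt (fun τ => V τ * (u - x τ)) s :=
    hV.self_of_nhds.continuousAt.mul
      (continuousAt_const.sub hx.self_of_nhds.continuousAt)
  have hVs : V s = x₁ s * Y := by simp [V, ey₁]
  have hWs : W s = 0 := by simp [W, ex, ey]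
  have hzero := third_deriv_eq_zero_of_pairs hS hS₁ hS₂ (by simp [ey, hWs])
    (by simp [ey, ey₁, ex, hWs])
    (by simp only [ey, ey₁, ex, hWs, hVs, hκ]; field_simp; ring) hVc
    (by simp [hVs, ex, hu, ex₁, hY])
    (by
      intro δ hδ
      obtain ⟨p, hp, q, hq, h1, h2⟩ := hpq δ hδ
      refine ⟨p, hp, q, hq, ?_⟩
      simp only [V, W]
      linear_combination (x₁ p * Y - y₁ p * X) * (x₁ q * Y - y₁ q * X) * h2 -
        κ * (u - x p) * (u - x q) * h1)
  simp only [ey, ey₁, ex, hWs, hVs, hκ] at hzero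
  field_simp at hzero ⊢
  linear_combination -hzero

/-! ### Determinants in the plane -/

theorem planeDet_sub_right (u v w : Plane) : planeDet u (v - w) = planeDet u v - planeDet u w := by
  simp [planeDet]; ring

/-- The Plücker relation for four vectors of the plane. -/
theorem planeDet_mul_sub (w v a b : Plane) :
    planeDet w a * planeDet v b - planeDet w b * planeDet v a = planeDet w v * planeDet a b := by
  simp only [planeDet]; ring

theorem exists_smul_eq_of_planeDet_eq_zero {u v : Plane} (hv : v ≠ 0) (h : planeDet v u = 0) :
    ∃ c : ℝ, c • v = u := by
  have hpos : v 0 ^ 2 + v 1 ^ 2 ≠ 0 := by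
    intro h0
    apply hv
    ext i
    fin_cases i
    · simp; nlinarith [sq_nonneg (v 0), sq_nonneg (v 1)]
    · simp; nlinarith [sq_nonneg (v 0), sq_nonneg (v 1)]
  refine ⟨(v 0 * u 0 + v 1 * u 1) / (v 0 ^ 2 + v 1 ^ 2), ?_⟩
  simp only [planeDet] at h
  ext i
  fin_cases i
  · simp
    field_simp
    linear_combination v 1 * h
  · simp
    field_simp
    linear_combination -v 0 * h

theorem mem_tangentLine_of_planeDet_eq_zero {γ : ℝ → Plane} {t : ℝ} {A : Plane}
    (ht : deriv γ t ≠ 0) (h : planeDet (deriv γ t) (A - γ t) = 0) : A ∈ tangentLine γ t := by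
  rw [tangentLine, AffineSubspace.mem_mk', vsub_eq_sub, Submodule.mem_span_singleton]
  exact exists_smul_eq_of_planeDet_eq_zero ht h

theorem planeDet_eq_zero_of_mem_line {P Q A : Plane} (h : A ∈ line[ℝ, P, Q]) :
    planeDet (Q - P) (A - P) = 0 := by
  have hv := AffineSubspace.vsub_mem_direction h (left_mem_affineSpan_pair ℝ P Q)
  rw [direction_affineSpan, mem_vectorSpan_pair_rev] at hv
  obtain ⟨r, hr⟩ := hv
  rw [vsub_eq_sub, vsub_eq_sub] at hr
  rw [← hr]
  simp only [planeDet, PiLp.smul_apply, smul_eq_mul]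
  ring

theorem HasDerivAt.plane_apply {γ : ℝ → Plane} {v : Plane} {t : ℝ} (h : HasDerivAt γ v t)
    (i : Fin 2) : HasDerivAt (fun τ => γ τ i) (v i) t :=
  (EuclideanSpace.proj (𝕜 := ℝ) i).hasFDerivAt.comp_hasDerivAt t h

theorem HasDerivAt.planeDet_right {γ : ℝ → Plane} {v : Plane} {t : ℝ} (h : HasDerivAt γ v t)
    (u : Plane) : HasDerivAt (fun τ => planeDet u (γ τ)) (planeDet u v) t :=
  ((h.plane_apply 1).const_mul (u 0)).sub ((h.plane_apply 0).const_mul (u 1))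

theorem ContinuousOn.planeDet {f g : ℝ → Plane} {I : Set ℝ} (hf : ContinuousOn f I)
    (hg : ContinuousOn g I) : ContinuousOn (fun τ => planeDet (f τ) (g τ)) I := by
  unfold _root_.planeDet
  fun_prop

/-! ### Strictly convex arcs and their tangent lines -/

namespace IsSmoothConvexArc

variable {γ : ℝ → Plane} {I J : Set ℝ} {α β σ : ℝ} {w : Plane}

theorem contDiffOn_iterate_deriv (hγ : IsSmoothConvexArc γ I) (hI : IsOpen I) (n : ℕ) :
    ContDiffOn ℝ ∞ (deriv^[n] γ) I := by
  induction n with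
  | zero => exact hγ.smooth
  | succ n ih =>
    rw [Function.iterate_succ_apply']
    exact ih.deriv_of_isOpen hI (by simp)

theorem hasDerivAt_iterate_deriv (hγ : IsSmoothConvexArc γ I) (hI : IsOpen I) (n : ℕ) {t : ℝ}
    (ht : t ∈ I) : HasDerivAt (deriv^[n] γ) (deriv^[n + 1] γ t) t := by
  rw [Function.iterate_succ_apply']
  exact (((hγ.contDiffOn_iterate_deriv hI n).contDiffAt (hI.mem_nhds ht)).differentiableAt
    (by simp)).hasDerivAt

theorem continuousOn_deriv (hγ : IsSmoothConvexArc γ I) (hI : IsOpen I) :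
    ContinuousOn (deriv γ) I := (hγ.contDiffOn_iterate_deriv hI 1).continuousOn

/-- The side of the tangent line on which the arc lies does not depend on the point of tangency, by
continuity; `σ` encodes it. -/
theorem exists_sign (hγ : IsSmoothConvexArc γ (Ioo α β)) :
    ∃ σ : ℝ, ∀ s ∈ Ioo α β, ∀ t ∈ Ioo α β, t ≠ s →
      0 < σ * planeDet (deriv γ s) (γ t - γ s) := by
  have hmix : ∀ s ∈ Ioo α β, ∀ r ∈ Ioo α β,
      (∀ t ∈ Ioo α β, t ≠ s → 0 < planeDet (deriv γ s) (γ t - γ s)) →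
      (∀ t ∈ Ioo α β, t ≠ r → planeDet (deriv γ r) (γ t - γ r) < 0) → False := by
    intro s hs r hr hpos hneg
    obtain ⟨t, ht, htβ⟩ := exists_between (max_lt hs.2 hr.2)
    have hts := (le_max_left s r).trans_lt ht
    have htr := (le_max_right s r).trans_lt ht
    have htI : t ∈ Ioo α β := ⟨hs.1.trans hts, htβ⟩
    have hsub : Ioo α t ⊆ Ioo α β := Ioo_subset_Ioo_right htβ.le
    have hcont : ContinuousOn (fun τ => planeDet (deriv γ τ) (γ t - γ τ)) (Ioo α t) :=
      ((hγ.continuousOn_deriv isOpen_Ioo).planeDet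
        (continuousOn_const.sub hγ.smooth.continuousOn)).mono hsub
    obtain ⟨z, hz, hz0⟩ := (isPreconnected_Ioo (a := α) (b := t)).intermediate_value
      ⟨hr.1, htr⟩ ⟨hs.1, hts⟩ hcont ⟨(hneg t htI htr.ne').le, (hpos t htI hts.ne').le⟩
    rcases hγ.convex z (hsub hz) with h | h
    · exact (h t htI hz.2.ne').ne' hz0
    · exact (h t htI hz.2.ne').ne hz0
  by_cases h : ∀ s ∈ Ioo α β, ∀ t ∈ Ioo α β, t ≠ s → 0 < planeDet (deriv γ s) (γ t - γ s)
  · exact ⟨1, by simpa using h⟩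
  · push Not at h
    obtain ⟨r, hr, t, ht, htr, hle⟩ := h
    have hneg := (hγ.convex r hr).resolve_left fun h => (h t ht htr).not_ge hle
    refine ⟨-1, fun s hs t ht hts => ?_⟩
    rcases hγ.convex s hs with h | h
    · exact (hmix s hs r hr h hneg).elim
    · linarith [h t ht hts]

/-- The coordinate `planeDet w` increases along the part of the arc where `w` is transversal to the
velocity. -/
theorem planeDet_chord_pos (hγ : IsSmoothConvexArc γ I) (hI : IsOpen I) (hJI : J ⊆ I)
    (hJ : J.OrdConnected) (hw : ∀ t ∈ J, 0 < planeDet w (deriv γ t)) {s t : ℝ} (hs : s ∈ J)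
    (ht : t ∈ J) (hst : s < t) : 0 < planeDet w (γ t - γ s) := by
  have hd : ∀ τ ∈ J, HasDerivAt (fun τ => planeDet w (γ τ)) (planeDet w (deriv γ τ)) τ :=
    fun τ hτ => (hγ.hasDerivAt_iterate_deriv hI 0 (hJI hτ)).planeDet_right w
  have : StrictMonoOn (fun τ => planeDet w (γ τ)) J := by
    refine strictMonoOn_of_deriv_pos hJ.convex
      (fun τ hτ => (hd τ hτ).continuousAt.continuousWithinAt) fun τ hτ => ?_
    rw [(hd τ (interior_subset hτ)).deriv]
    exact hw τ (interior_subset hτ)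
  rw [planeDet_sub_right]
  exact sub_pos.2 (this hs ht hst)

/-- The velocity turns strictly monotonically, even through points of zero curvature. -/
theorem planeDet_deriv_pos (hγ : IsSmoothConvexArc γ I) (hI : IsOpen I) (hJI : J ⊆ I)
    (hJ : J.OrdConnected) (hw : ∀ t ∈ J, 0 < planeDet w (deriv γ t))
    (hσ : ∀ s ∈ I, ∀ t ∈ I, t ≠ s → 0 < σ * planeDet (deriv γ s) (γ t - γ s))
    {s t : ℝ} (hs : s ∈ J) (ht : t ∈ J) (hst : s < t) :
    0 < σ * planeDet (deriv γ s) (deriv γ t) := by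
  have h := hγ.planeDet_chord_pos hI hJI hJ hw hs ht hst
  have h₁ := mul_pos (hw t ht) (hσ s (hJI hs) t (hJI ht) hst.ne')
  have h₂ := mul_pos (hw s hs) (hσ t (hJI ht) s (hJI hs) hst.ne)
  refine pos_of_mul_pos_right ?_ h.le
  have e := planeDet_mul_sub w (deriv γ s) (γ t - γ s) (deriv γ t)
  have e' : planeDet (deriv γ t) (γ s - γ t) = planeDet (γ t - γ s) (deriv γ t) := by
    simp [planeDet]; ring
  rw [e'] at h₂
  linear_combination h₁ + h₂ - σ * e

/-- An intermediate point of the arc lies strictly on the convex side of a chord. -/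
theorem planeDet_chords_pos (hγ : IsSmoothConvexArc γ I) (hI : IsOpen I) (hJI : J ⊆ I)
    (hJ : J.OrdConnected) (hw : ∀ t ∈ J, 0 < planeDet w (deriv γ t))
    (hσ : ∀ s ∈ I, ∀ t ∈ I, t ≠ s → 0 < σ * planeDet (deriv γ s) (γ t - γ s))
    {s r t : ℝ} (hs : s ∈ J) (hr : r ∈ J) (ht : t ∈ J) (hsr : s < r) (hrt : r < t) :
    0 < σ * planeDet (γ r - γ s) (γ t - γ r) := by
  have h₁ := mul_pos (hγ.planeDet_chord_pos hI hJI hJ hw hs hr hsr)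
    (hσ r (hJI hr) t (hJI ht) hrt.ne')
  have h₂ := mul_pos (hγ.planeDet_chord_pos hI hJI hJ hw hr ht hrt)
    (hσ r (hJI hr) s (hJI hs) hsr.ne)
  refine pos_of_mul_pos_right ?_ (hw r hr).le
  have e := planeDet_mul_sub w (γ r - γ s) (deriv γ r) (γ t - γ r)
  have e' : planeDet (deriv γ r) (γ s - γ r) = planeDet (γ r - γ s) (deriv γ r) := by
    simp [planeDet]; ring
  rw [e'] at h₂
  linear_combination h₁ + h₂ - σ * e

end IsSmoothConvexArc

/-- The intersection point of the tangent lines of `γ` at `γ s` and `γ t`, provided that they are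
not parallel. -/
noncomputable def tangentMeet (γ : ℝ → Plane) (s t : ℝ) : Plane :=
  γ s + (planeDet (deriv γ t) (γ s - γ t) / planeDet (deriv γ s) (deriv γ t)) • deriv γ s

theorem tangentMeet_sub_left (γ : ℝ → Plane) (s t : ℝ) : tangentMeet γ s t - γ s =
    (planeDet (deriv γ t) (γ s - γ t) / planeDet (deriv γ s) (deriv γ t)) • deriv γ s := by
  simp [tangentMeet]

theorem tangentMeet_sub_right {γ : ℝ → Plane} {s t : ℝ}
    (h : planeDet (deriv γ s) (deriv γ t) ≠ 0) : tangentMeet γ s t - γ t =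
    -(planeDet (deriv γ s) (γ t - γ s) / planeDet (deriv γ s) (deriv γ t)) • deriv γ t := by
  ext i
  fin_cases i <;>
  · simp [tangentMeet]
    field_simp
    simp [planeDet]
    ring

namespace IsSmoothConvexArc

variable {γ : ℝ → Plane} {I J : Set ℝ} {σ : ℝ} {w : Plane}

/-- The two tangent segments from the intersection point of the tangent lines at `γ s` and `γ t` are
described by positive coefficients: the point lies ahead of `γ s` and behind `γ t`. -/
theorem tangentMeet_coeff_pos (hγ : IsSmoothConvexArc γ I) (hI : IsOpen I) (hJI : J ⊆ I)
    (hJ : J.OrdConnected) (hw : ∀ t ∈ J, 0 < planeDet w (deriv γ t))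
    (hσ : ∀ s ∈ I, ∀ t ∈ I, t ≠ s → 0 < σ * planeDet (deriv γ s) (γ t - γ s))
    {s t : ℝ} (hs : s ∈ J) (ht : t ∈ J) (hst : s < t) :
    0 < planeDet (deriv γ t) (γ s - γ t) / planeDet (deriv γ s) (deriv γ t) ∧
      0 < planeDet (deriv γ s) (γ t - γ s) / planeDet (deriv γ s) (deriv γ t) := by
  have hD := hγ.planeDet_deriv_pos hI hJI hJ hw hσ hs ht hst
  have hσ₀ : σ ≠ 0 := fun h => by simp [h] at hD
  constructor
  · rw [← mul_div_mul_left _ _ hσ₀]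
    exact div_pos (hσ t (hJI ht) s (hJI hs) hst.ne) hD
  · rw [← mul_div_mul_left _ _ hσ₀]
    exact div_pos (hσ s (hJI hs) t (hJI ht) hst.ne') hD

/-- The tangent line at any parameter strictly between `s` and `t` passes through the interior of
the triangle formed by `γ s`, `γ t` and the intersection point `A` of the tangent lines there, and
leaves `γ s` and `γ t` on the same side, so it separates `A` from the arc. -/
theorem onConcaveSide_tangentMeet (hγ : IsSmoothConvexArc γ I) (hI : IsOpen I) (hJI : J ⊆ I)
    (hJ : J.OrdConnected) (hw : ∀ t ∈ J, 0 < planeDet w (deriv γ t))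
    (hσ : ∀ s ∈ I, ∀ t ∈ I, t ≠ s → 0 < σ * planeDet (deriv γ s) (γ t - γ s))
    {s t : ℝ} (hs : s ∈ J) (ht : t ∈ J) (hst : s < t) :
    OnConcaveSide γ I (tangentMeet γ s t) := by
  obtain ⟨r, hsr, hrt⟩ := exists_between hst
  have hr : r ∈ J := hJ.out hs ht ⟨hsr.le, hrt.le⟩
  have hD := hγ.planeDet_deriv_pos hI hJI hJ hw hσ hs ht hst
  have hD₀ : planeDet (deriv γ s) (deriv γ t) ≠ 0 := fun h => by simp [h] at hD
  have hσ₀ : σ ≠ 0 := fun h => by simp [h] at hD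
  obtain ⟨hl, hm⟩ := hγ.tangentMeet_coeff_pos hI hJI hJ hw hσ hs ht hst
  have eA := tangentMeet_sub_left γ s t
  have eB := tangentMeet_sub_right hD₀
  set A := tangentMeet γ s t
  generalize planeDet (deriv γ t) (γ s - γ t) / planeDet (deriv γ s) (deriv γ t) = l at hl eA
  generalize planeDet (deriv γ s) (γ t - γ s) / planeDet (deriv γ s) (deriv γ t) = m at hm eB
  have hsr' := mul_pos hl (hσ s (hJI hs) r (hJI hr) hsr.ne')
  have htr' := mul_pos hm (hσ t (hJI ht) r (hJI hr) hrt.ne)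
  have hrs' := hσ r (hJI hr) s (hJI hs) hsr.ne
  have hrt' := hσ r (hJI hr) t (hJI ht) hrt.ne'
  have hch := hγ.planeDet_chords_pos hI hJI hJ hw hσ hs hr ht hsr hrt
  -- `k₁`, `k₂`, `k₃` are, up to a common factor, the barycentric coordinates of `γ r` in the
  -- triangle with vertices `γ t`, `γ s` and `A`.
  have k₁ : 0 < σ * planeDet (A - γ s) (γ r - γ s) := by
    rw [eA]
    refine hsr'.trans_eq ?_
    simp only [planeDet, PiLp.smul_apply, smul_eq_mul]
    ring
  have k₂ : 0 < σ * planeDet (γ r - γ t) (A - γ t) := by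
    rw [eB]
    refine htr'.trans_eq ?_
    simp only [planeDet, PiLp.smul_apply, smul_eq_mul]
    ring
  have k₃ : 0 < σ * planeDet (γ r - γ s) (γ t - γ r) := hch
  have key : 0 < σ * planeDet (deriv γ r) (γ r - A) := by
    have h := add_pos (mul_pos k₁ hrt') (mul_pos k₂ hrs')
    refine pos_of_mul_pos_right (a := σ * planeDet (γ r - γ s) (γ t - γ r)) ?_ k₃.le
    convert h using 1
    simp only [planeDet, PiLp.sub_apply]
    ring
  refine ⟨r, hJI hr, fun τ hτ hne => ?_⟩
  have h := mul_pos key (hσ r (hJI hr) τ hτ hne)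
  have hσ2 : 0 < σ ^ 2 := by positivity
  refine neg_of_mul_neg_right (a := σ ^ 2) ?_ hσ2.le
  refine neg_of_neg_pos ?_
  convert h using 1
  simp only [planeDet, PiLp.sub_apply]
  ring

/-- Use of the duality hypothesis: if the line through `γ s` and `γ t` is dual to `A`, and
`B = γ s - ε • (γ t - γ s)` is a point of that line just outside the arc, then the tangent lines
from `B` touch the arc at parameters `p < s < q` close to `s`, and `A` lies on the line through
`γ p` and `γ q`. -/
theorem exists_tangents_near (hγ : IsSmoothConvexArc γ I) (hI : IsOpen I) (hJI : J ⊆ I)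
    (hJo : IsOpen J) (hJ : J.OrdConnected) (hw : ∀ t ∈ J, 0 < planeDet w (deriv γ t))
    (hσ : ∀ s ∈ I, ∀ t ∈ I, t ≠ s → 0 < σ * planeDet (deriv γ s) (γ t - γ s))
    {U : Set Plane} (hdual : DualityPreservesIncidence γ I U)
    {s t : ℝ} (hs : s ∈ J) (ht : t ∈ J) (hst : s < t) (hU : U ∈ 𝓝 (γ s))
    (hA : tangentMeet γ s t ∈ U) {δ : ℝ} (hδ : 0 < δ) :
    ∃ p ∈ Ioo (s - δ) s, ∃ q ∈ Ioo s (s + δ), ∃ ε : ℝ, 0 < ε ∧ p ∈ J ∧ q ∈ J ∧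
      planeDet (deriv γ p) (γ s - ε • (γ t - γ s) - γ p) = 0 ∧
      planeDet (deriv γ q) (γ s - ε • (γ t - γ s) - γ q) = 0 ∧
      planeDet (γ q - γ p) (tangentMeet γ s t - γ p) = 0 := by
  obtain ⟨η, hη, hηJ⟩ := Metric.isOpen_iff.1 hJo s hs
  have hJmem : ∀ τ, |τ - s| < η → τ ∈ J := fun τ h => hηJ (by simpa [Real.dist_eq] using h)
  obtain ⟨ρ, hρ, hρm⟩ := exists_between (lt_min hδ hη)
  have hρδ := hρm.trans_le (min_le_left _ _)
  have hρη := hρm.trans_le (min_le_right _ _)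
  have hp₀ : s - ρ ∈ J := hJmem _ (by rw [abs_lt]; constructor <;> linarith)
  have hq₀ : s + ρ ∈ J := hJmem _ (by rw [abs_lt]; constructor <;> linarith)
  have hBc : Continuous fun ε : ℝ => γ s - ε • (γ t - γ s) := by fun_prop
  have hpos : ∀ r ∈ J, r ≠ s → ∀ᶠ ε : ℝ in 𝓝[>] 0,
      0 < σ * planeDet (deriv γ r) (γ s - ε • (γ t - γ s) - γ r) := by
    intro r hr hrs
    have hc : Continuous fun ε : ℝ =>
        σ * planeDet (deriv γ r) (γ s - ε • (γ t - γ s) - γ r) := by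
      unfold planeDet
      fun_prop
    refine ((hc.tendsto 0).mono_left nhdsWithin_le_nhds).eventually_const_lt ?_
    simpa using hσ r (hJI hr) s (hJI hs) hrs.symm
  have hBU : ∀ᶠ ε : ℝ in 𝓝[>] 0, γ s - ε • (γ t - γ s) ∈ U :=
    ((hBc.tendsto 0).mono_left nhdsWithin_le_nhds).eventually (by simpa using hU)
  obtain ⟨ε, ⟨hεp, hεq, hεU⟩, hε⟩ := (((hpos _ hp₀ (by linarith)).and
    ((hpos _ hq₀ (by linarith)).and hBU)).and self_mem_nhdsWithin).exists
  replace hε : 0 < ε := hε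
  set B := γ s - ε • (γ t - γ s) with hB
  have hBs : planeDet (deriv γ s) (B - γ s) = -ε * planeDet (deriv γ s) (γ t - γ s) := by
    simp [hB, planeDet]
    ring
  have hstσ := hσ s (hJI hs) t (hJI ht) hst.ne'
  -- `B` lies on the other side of the tangent line at `γ s` than the arc, but on the same side of
  -- the tangent lines at `s - ρ` and `s + ρ`; hence the sign changes that produce `p` and `q`.
  have hneg : σ * planeDet (deriv γ s) (B - γ s) < 0 := by
    rw [hBs]
    nlinarith
  have hcont : ContinuousOn (fun τ => σ * planeDet (deriv γ τ) (B - γ τ)) J :=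
    continuousOn_const.mul (((hγ.continuousOn_deriv hI).planeDet
      (continuousOn_const.sub hγ.smooth.continuousOn)).mono hJI)
  have hσ₀ : σ ≠ 0 := fun h => by simp [h] at hstσ
  obtain ⟨p, hp, hp0⟩ := intermediate_value_Ioo' (by linarith : s - ρ ≤ s)
    (hcont.mono (hJ.out hp₀ hs)) ⟨hneg, hεp⟩
  obtain ⟨q, hq, hq0⟩ := intermediate_value_Ioo (by linarith : s ≤ s + ρ)
    (hcont.mono (hJ.out hs hq₀)) ⟨hneg, hεq⟩
  have hpJ : p ∈ J := hJ.out hp₀ hs ⟨hp.1.le, hp.2.le⟩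
  have hqJ : q ∈ J := hJ.out hs hq₀ ⟨hq.1.le, hq.2.le⟩
  replace hp0 := (mul_eq_zero.1 hp0).resolve_left hσ₀
  replace hq0 := (mul_eq_zero.1 hq0).resolve_left hσ₀
  refine ⟨p, ⟨by linarith [hp.1], hp.2⟩, q, ⟨hq.1, by linarith [hq.2]⟩, ε, hε, hpJ, hqJ, hp0, hq0,
    ?_⟩
  have hD := hγ.planeDet_deriv_pos hI hJI hJ hw hσ hs ht hst
  have hD₀ : planeDet (deriv γ s) (deriv γ t) ≠ 0 := fun h => by simp [h] at hD
  have hAc := hγ.onConcaveSide_tangentMeet hI hJI hJ hw hσ hs ht hst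
  have hBc : OnConcaveSide γ I B := by
    refine ⟨s, hJI hs, fun τ hτ hne => ?_⟩
    have h := mul_pos (neg_pos.2 hneg) (hσ s (hJI hs) τ hτ hne)
    have hσ2 : 0 < σ ^ 2 := by positivity
    refine neg_of_mul_neg_right (a := σ ^ 2) ?_ hσ2.le
    linarith
  refine planeDet_eq_zero_of_mem_line (hdual _ hA _ hεU _ _
    ⟨hAc, s, hJI hs, t, hJI ht, hst.ne, ?_, ?_, rfl⟩
    ⟨hBc, p, hJI hpJ, q, hJI hqJ, (hp.2.trans hq.1).ne, ?_, ?_, rfl⟩ ?_)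
  · refine mem_tangentLine_of_planeDet_eq_zero (hγ.regular s (hJI hs)) ?_
    rw [tangentMeet_sub_left]
    simp [planeDet]
    ring
  · refine mem_tangentLine_of_planeDet_eq_zero (hγ.regular t (hJI ht)) ?_
    rw [tangentMeet_sub_right hD₀]
    simp [planeDet]
    ring
  · exact mem_tangentLine_of_planeDet_eq_zero (hγ.regular p (hJI hpJ)) hp0
  · exact mem_tangentLine_of_planeDet_eq_zero (hγ.regular q (hJI hqJ)) hq0
  · have hmem := AffineMap.lineMap_mem_affineSpan_pair (-ε) (γ s) (γ t)
    rwa [AffineMap.lineMap_apply_module', neg_smul, add_comm, ← sub_eq_add_neg] at hmem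

end IsSmoothConvexArc

/-! ### A first integral, and conics in affine coordinates -/

/-- In the projective coordinates `ξ = X / Y`, `η = 1 / Y`, the relation of the hypothesis becomes
`(c * ξ + k) * ξ' = m * η'`, which integrates to a quadratic equation. -/
theorem exists_quadratic_relation {X Y X₁ Y₁ : ℝ → ℝ} {s b c k m : ℝ}
    (hX : ∀ t ∈ Ioo s b, HasDerivAt X (X₁ t) t) (hY : ∀ t ∈ Ioo s b, HasDerivAt Y (Y₁ t) t)
    (hY₀ : ∀ t ∈ Ioo s b, Y t ≠ 0) (hu : ∀ t ∈ Ioo s b, X t * Y₁ t - X₁ t * Y t ≠ 0)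
    (h : ∀ t ∈ Ioo s b, c * (X t / Y t) + k = m / ((X t * Y₁ t - X₁ t * Y t) / Y₁ t)) :
    ∃ e : ℝ, ∀ t ∈ Ioo s b, c / 2 * X t ^ 2 + k * X t * Y t - m * Y t = e * Y t ^ 2 := by
  -- `F = c * ξ ^ 2 / 2 + k * ξ - m * η` is a first integral.
  let F : ℝ → ℝ := fun t => c / 2 * (X t / Y t) ^ 2 + k * (X t / Y t) - m * (Y t)⁻¹
  have hF : ∀ t ∈ Ioo s b, HasDerivAt F 0 t := by
    intro t ht
    have hw := (hX t ht).div (hY t ht) (hY₀ t ht)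
    refine (((((hw.pow 2).const_mul (c / 2)).add (hw.const_mul k)).sub
      (((hY t ht).inv (hY₀ t ht)).const_mul m))).congr_deriv ?_
    have h' := h t ht
    rw [div_div_eq_mul_div, eq_div_iff (hu t ht)] at h'
    have hy := hY₀ t ht
    simp only [Pi.div_apply, Nat.cast_ofNat, Nat.add_one_sub_one, pow_one]
    field_simp at h' ⊢
    linear_combination -h'
  rcases le_or_gt b s with hbs | hsb
  · exact ⟨0, fun t ht => absurd (ht.1.trans ht.2) hbs.not_gt⟩
  obtain ⟨t₁, ht₁⟩ := nonempty_Ioo.2 hsb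
  refine ⟨F t₁, fun t ht => ?_⟩
  have hconst : F t = F t₁ := (convex_Ioo s b).is_const_of_fderivWithin_eq_zero (𝕜 := ℝ)
    (fun τ hτ => (hF τ hτ).differentiableAt.differentiableWithinAt)
    (fun τ hτ => by
      rw [fderivWithin_of_isOpen isOpen_Ioo hτ]
      ext
      simp [(hF τ hτ).deriv]) ht ht₁
  rw [← hconst]
  have hy := hY₀ t ht
  simp only [F]
  field_simp

/-- The pull-back of the conic `c / 2 * X ^ 2 + k * X * Y - m * Y = e * Y ^ 2` under an affine
change of coordinates. Its determinant is a multiple of `c * m ^ 2`, so that it is non-degenerate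
for all `k` and `e`. -/
theorem isConic_of_quadratic {w v : Plane} {d₀ d₁ c k m e : ℝ} (hwv : planeDet w v ≠ 0)
    (hc : c ≠ 0) (hm : m ≠ 0) :
    IsConic {P : Plane | c / 2 * (planeDet w P - d₀) ^ 2
      + k * (planeDet w P - d₀) * (planeDet v P - d₁) - m * (planeDet v P - d₁)
        = e * (planeDet v P - d₁) ^ 2} := by
  let N : Matrix (Fin 3) (Fin 3) ℝ := !![c / 2, k / 2, 0; k / 2, -e, -m / 2; 0, -m / 2, 0]
  let T : Matrix (Fin 3) (Fin 3) ℝ := !![-w 1, w 0, -d₀; -v 1, v 0, -d₁; 0, 0, 1]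
  have hN : Nᵀ = N := by
    ext i j
    fin_cases i <;> fin_cases j <;> rfl
  refine ⟨Tᵀ * N * T, ?_, ?_, ?_⟩
  · rw [Matrix.IsSymm, Matrix.transpose_mul, Matrix.transpose_mul, Matrix.transpose_transpose, hN,
      Matrix.mul_assoc]
  · have hT : T.det = planeDet w v := by
      simp [T, Matrix.det_fin_three, planeDet]
      ring
    have hNd : N.det = -(c / 2) * (m / 2) ^ 2 := by
      simp [N, Matrix.det_fin_three]
      ring
    rw [Matrix.det_mul, Matrix.det_mul, Matrix.det_transpose, hT, hNd]
    have : -(c / 2) * (m / 2) ^ 2 ≠ 0 := by simp [hc, hm]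
    exact mul_ne_zero (mul_ne_zero hwv this) hwv
  · ext P
    have hTP : T *ᵥ ![P 0, P 1, 1] = ![planeDet w P - d₀, planeDet v P - d₁, 1] := by
      ext i
      fin_cases i <;> simp [T, Matrix.mulVec, dotProduct, Fin.sum_univ_three, planeDet] <;> ring
    rw [mem_ofPred_eq, mem_ofPred_eq, ← Matrix.mulVec_mulVec, ← Matrix.mulVec_mulVec,
      Matrix.dotProduct_mulVec, Matrix.vecMul_transpose, hTP, ← sub_eq_zero]
    refine Eq.congr ?_ rfl
    simp [N, Matrix.mulVec, dotProduct, Fin.sum_univ_three]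
    ring

/-! ### From the duality to the differential equation -/

namespace IsSmoothConvexArc

variable {γ : ℝ → Plane} {I J : Set ℝ} {σ : ℝ} {w : Plane}

/-- With respect to the coordinate `planeDet w`, the intersection point of two tangent lines lies
between the points of tangency. -/
theorem tangentMeet_coord (hγ : IsSmoothConvexArc γ I) (hI : IsOpen I) (hJI : J ⊆ I)
    (hJ : J.OrdConnected) (hw : ∀ t ∈ J, 0 < planeDet w (deriv γ t))
    (hσ : ∀ s ∈ I, ∀ t ∈ I, t ≠ s → 0 < σ * planeDet (deriv γ s) (γ t - γ s))
    {s t : ℝ} (hs : s ∈ J) (ht : t ∈ J) (hst : s < t) :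
    0 < planeDet w (tangentMeet γ s t - γ s) ∧
      planeDet w (tangentMeet γ s t - γ s) < planeDet w (γ t - γ s) := by
  have hD := hγ.planeDet_deriv_pos hI hJI hJ hw hσ hs ht hst
  have hD₀ : planeDet (deriv γ s) (deriv γ t) ≠ 0 := fun h => by simp [h] at hD
  obtain ⟨hl, hm⟩ := hγ.tangentMeet_coeff_pos hI hJI hJ hw hσ hs ht hst
  have e₁ : planeDet w (tangentMeet γ s t - γ s) =
      planeDet (deriv γ t) (γ s - γ t) / planeDet (deriv γ s) (deriv γ t) *
        planeDet w (deriv γ s) := by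
    rw [tangentMeet_sub_left]
    simp only [planeDet, PiLp.smul_apply, smul_eq_mul]
    ring
  have e₂ : planeDet w (tangentMeet γ s t - γ t) =
      -(planeDet (deriv γ s) (γ t - γ s) / planeDet (deriv γ s) (deriv γ t) *
        planeDet w (deriv γ t)) := by
    rw [tangentMeet_sub_right hD₀]
    simp only [planeDet, PiLp.smul_apply, smul_eq_mul]
    ring
  have h₁ := mul_pos hl (hw s hs)
  have h₂ := mul_pos hm (hw t ht)
  refine ⟨e₁ ▸ h₁, ?_⟩
  rw [planeDet_sub_right] at e₂ ⊢
  rw [planeDet_sub_right]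
  linarith

/-- Near `t₀` a fixed vector `w` is transversal to the arc, the points of the arc lie in the
interior of `U`, and the intersection points of its tangent lines lie in `U`. -/
theorem exists_interval (hγ : IsSmoothConvexArc γ I) (hI : IsOpen I)
    (hσ : ∀ s ∈ I, ∀ t ∈ I, t ≠ s → 0 < σ * planeDet (deriv γ s) (γ t - γ s))
    {t₀ : ℝ} (ht₀ : t₀ ∈ I) {U : Set Plane} (hU : U ∈ 𝓝 (γ t₀)) :
    ∃ w : Plane, ∃ δ > 0, Ioo (t₀ - δ) (t₀ + δ) ⊆ I ∧
      (∀ t ∈ Ioo (t₀ - δ) (t₀ + δ), 0 < planeDet w (deriv γ t)) ∧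
      (∀ t ∈ Ioo (t₀ - δ) (t₀ + δ), U ∈ 𝓝 (γ t)) ∧
      ∀ s ∈ Ioo (t₀ - δ) (t₀ + δ), ∀ t ∈ Ioo (t₀ - δ) (t₀ + δ), s < t → tangentMeet γ s t ∈ U := by
  let w : Plane := !₂[deriv γ t₀ 1, -deriv γ t₀ 0]
  have hw₀ : 0 < planeDet w (deriv γ t₀) := by
    have h : planeDet w (deriv γ t₀) = deriv γ t₀ 0 ^ 2 + deriv γ t₀ 1 ^ 2 := by
      simp [planeDet, w]
      ring
    rw [h]
    by_contra hle
    refine hγ.regular t₀ ht₀ ?_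
    ext i
    fin_cases i
    · simp; nlinarith [sq_nonneg (deriv γ t₀ 0), sq_nonneg (deriv γ t₀ 1)]
    · simp; nlinarith [sq_nonneg (deriv γ t₀ 0), sq_nonneg (deriv γ t₀ 1)]
  have hI₀ := hI.mem_nhds ht₀
  have hγc : ContinuousAt γ t₀ := hγ.smooth.continuousOn.continuousAt hI₀
  have hdc : ContinuousAt (deriv γ) t₀ := (hγ.continuousOn_deriv hI).continuousAt hI₀
  have hwc : ContinuousAt (fun t => planeDet w (γ t)) t₀ :=
    (continuousOn_const.planeDet hγ.smooth.continuousOn).continuousAt hI₀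
  have hwdc : ContinuousAt (fun t => planeDet w (deriv γ t)) t₀ :=
    (continuousOn_const.planeDet (hγ.continuousOn_deriv hI)).continuousAt hI₀
  obtain ⟨ρ, hρ, hρU⟩ := Metric.mem_nhds_iff.1 hU
  -- `K` bounds the speed of `γ` by the speed of its coordinate `planeDet w γ`.
  obtain ⟨K, hK⟩ := exists_gt (‖deriv γ t₀‖ / planeDet w (deriv γ t₀))
  have hK₀ : 0 < K := (by positivity : 0 ≤ ‖deriv γ t₀‖ / planeDet w (deriv γ t₀)).trans_lt hK
  have hev : ∀ᶠ t in 𝓝 t₀, t ∈ I ∧ 0 < planeDet w (deriv γ t) ∧ dist (γ t) (γ t₀) < ρ / 2 ∧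
      ‖deriv γ t‖ < K * planeDet w (deriv γ t) ∧
      dist (planeDet w (γ t)) (planeDet w (γ t₀)) < ρ / (4 * K) := by
    refine Filter.Eventually.and hI₀ ((hwdc.eventually_const_lt hw₀).and
      ((hγc.eventually (Metric.ball_mem_nhds _ (by positivity))).and
        ((hdc.norm.eventually_lt (hwdc.const_mul K) ?_).and
          (hwc.eventually (Metric.ball_mem_nhds _ (by positivity))))))
    rwa [div_lt_iff₀ hw₀] at hK
  obtain ⟨δ, hδ, hball⟩ := Metric.eventually_nhds_iff_ball.1 hev
  rw [Real.ball_eq_Ioo] at hball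
  have hJI : Ioo (t₀ - δ) (t₀ + δ) ⊆ I := fun t ht => (hball t ht).1
  have hw : ∀ t ∈ Ioo (t₀ - δ) (t₀ + δ), 0 < planeDet w (deriv γ t) :=
    fun t ht => (hball t ht).2.1
  refine ⟨w, δ, hδ, hJI, hw, fun t ht => ?_, fun s hs t ht hst => hρU ?_⟩
  · refine Filter.mem_of_superset (Metric.isOpen_ball.mem_nhds ?_) hρU
    exact ((hball t ht).2.2.1).trans (half_lt_self hρ)
  · obtain ⟨-, hws, hs₁, hs₂, hs₃⟩ := hball s hs
    obtain ⟨-, -, -, -, ht₃⟩ := hball t ht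
    have hlt := (hγ.tangentMeet_coord hI hJI ordConnected_Ioo hw hσ hs ht hst).2
    have hl := (hγ.tangentMeet_coeff_pos hI hJI ordConnected_Ioo hw hσ hs ht hst).1
    have hsub := tangentMeet_sub_left γ s t
    have hnorm : ‖tangentMeet γ s t - γ s‖ ≤ K * planeDet w (tangentMeet γ s t - γ s) := by
      have e : planeDet w (tangentMeet γ s t - γ s) =
          planeDet (deriv γ t) (γ s - γ t) / planeDet (deriv γ s) (deriv γ t) *
            planeDet w (deriv γ s) := by
        rw [hsub]
        simp only [planeDet, PiLp.smul_apply, smul_eq_mul]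
        ring
      rw [e, hsub, norm_smul, Real.norm_of_nonneg hl.le]
      nlinarith
    have hwst : planeDet w (γ t - γ s) < ρ / (2 * K) := by
      rw [planeDet_sub_right]
      rw [Real.dist_eq, abs_lt] at hs₃ ht₃
      have : ρ / (2 * K) = ρ / (4 * K) + ρ / (4 * K) := by field_simp; norm_num
      linarith [hs₃.1, ht₃.2]
    have hKρ : K * (ρ / (2 * K)) = ρ / 2 := by field_simp
    have h₁ : dist (tangentMeet γ s t) (γ s) < ρ / 2 := by
      rw [dist_eq_norm]
      nlinarith
    calc dist (tangentMeet γ s t) (γ t₀) ≤ dist (tangentMeet γ s t) (γ s) + dist (γ s) (γ t₀) :=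
          dist_triangle _ _ _
      _ < ρ := by linarith

/-- The curvature of a strictly convex arc is not identically zero on any interval. -/
theorem exists_planeDet_deriv_ne_zero (hγ : IsSmoothConvexArc γ I) (hI : IsOpen I) (hJI : J ⊆ I)
    (hJ : J.OrdConnected) (hw : ∀ t ∈ J, 0 < planeDet w (deriv γ t))
    (hσ : ∀ s ∈ I, ∀ t ∈ I, t ≠ s → 0 < σ * planeDet (deriv γ s) (γ t - γ s))
    {a b : ℝ} (ha : a ∈ J) (hb : b ∈ J) (hab : a < b) :
    ∃ s ∈ Ioo a b, planeDet (deriv γ s) (deriv (deriv γ) s) ≠ 0 := by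
  by_contra! h
  have hsub : Icc a b ⊆ J := hJ.out ha hb
  have hd : ∀ v : Plane, ∀ t ∈ Icc a b, HasDerivAt (fun τ => planeDet v (deriv γ τ))
      (planeDet v (deriv (deriv γ) t)) t := fun v t ht =>
    (hγ.hasDerivAt_iterate_deriv hI 1 (hJI (hsub ht))).planeDet_right v
  -- The slope of the tangent line, with respect to the axes `w` and `deriv γ a`.
  have hslope : ∀ t ∈ Icc a b, HasDerivAt
      (fun τ => planeDet (deriv γ a) (deriv γ τ) / planeDet w (deriv γ τ))
      (planeDet w (deriv γ a) * planeDet (deriv γ t) (deriv (deriv γ) t) /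
        planeDet w (deriv γ t) ^ 2) t := by
    intro t ht
    refine ((hd _ t ht).div (hd w t ht) (hw t (hsub ht)).ne').congr_deriv ?_
    rw [← planeDet_mul_sub w (deriv γ a) (deriv γ t) (deriv (deriv γ) t)]
    ring
  obtain ⟨c, hc, hceq⟩ := exists_hasDerivAt_eq_slope _ _ hab
    (fun t ht => (hslope t ht).continuousAt.continuousWithinAt)
    (fun t ht => hslope t (Ioo_subset_Icc_self ht))
  have hD := hγ.planeDet_deriv_pos hI hJI hJ hw hσ ha hb hab
  have hself : planeDet (deriv γ a) (deriv γ a) = 0 := by simp only [planeDet]; ring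
  rw [h c hc, hself, mul_zero, zero_div, zero_div, sub_zero, eq_comm, div_eq_zero_iff,
    div_eq_zero_iff] at hceq
  rcases hceq with (h0 | h0) | h0
  · simp [h0] at hD
  · exact (hw b hb).ne' h0
  · linarith

/-- The third-order relation between the germ of the arc at `γ s`, the point `γ t` and the
intersection point of the tangent lines at `γ s` and `γ t`, where the constant `k` depends only on
the germ at `γ s`. -/
theorem tangentMeet_relation (hγ : IsSmoothConvexArc γ I) (hI : IsOpen I) (hJI : J ⊆ I)
    (hJo : IsOpen J) (hJ : J.OrdConnected) (hw : ∀ t ∈ J, 0 < planeDet w (deriv γ t))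
    (hσ : ∀ s ∈ I, ∀ t ∈ I, t ≠ s → 0 < σ * planeDet (deriv γ s) (γ t - γ s))
    {U : Set Plane} (hdual : DualityPreservesIncidence γ I U)
    {s : ℝ} (hs : s ∈ J) (hU : U ∈ 𝓝 (γ s))
    (hcurv : planeDet (deriv γ s) (deriv (deriv γ) s) ≠ 0) :
    ∃ k : ℝ, ∀ t ∈ J, s < t → tangentMeet γ s t ∈ U →
      planeDet (deriv γ s) (deriv (deriv γ) s) *
          (planeDet w (γ t - γ s) / planeDet (deriv γ s) (γ t - γ s)) + k =
        planeDet w (deriv γ s) ^ 2 / planeDet w (tangentMeet γ s t - γ s) := by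
  have hd : ∀ (v : Plane) (n : ℕ), ∀ τ ∈ I, HasDerivAt (fun τ => planeDet v (deriv^[n] γ τ))
      (planeDet v (deriv^[n + 1] γ τ)) τ := fun v n τ hτ =>
    (hγ.hasDerivAt_iterate_deriv hI n hτ).planeDet_right v
  have hd₀ : ∀ (v : Plane), ∀ τ ∈ I, HasDerivAt (fun τ => planeDet v (γ τ - γ s))
      (planeDet v (deriv γ τ)) τ := fun v τ hτ =>
    ((hγ.hasDerivAt_iterate_deriv hI 0 hτ).sub_const (γ s)).planeDet_right v
  have hIs := hI.mem_nhds (hJI hs)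
  refine ⟨(planeDet (deriv γ s) (deriv^[3] γ s) / planeDet (deriv γ s) (deriv (deriv γ) s) -
    3 * (planeDet w (deriv (deriv γ) s) / planeDet w (deriv γ s))) * planeDet w (deriv γ s) / 3,
    fun t ht hst hA => ?_⟩
  have hY : planeDet (deriv γ s) (γ t - γ s) ≠ 0 := fun h => by
    simpa [h] using hσ s (hJI hs) t (hJI ht) hst.ne'
  have hu := (hγ.tangentMeet_coord hI hJI hJ hw hσ hs ht hst).1
  refine third_order_contact_relation
    (x := fun τ => planeDet w (γ τ - γ s)) (y := fun τ => planeDet (deriv γ s) (γ τ - γ s))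
    (x₁ := fun τ => planeDet w (deriv γ τ)) (y₁ := fun τ => planeDet (deriv γ s) (deriv γ τ))
    (x₂ := fun τ => planeDet w (deriv (deriv γ) τ))
    (y₂ := fun τ => planeDet (deriv γ s) (deriv (deriv γ) τ))
    (x₃ := fun τ => planeDet w (deriv^[3] γ τ))
    (y₃ := fun τ => planeDet (deriv γ s) (deriv^[3] γ τ))
    (by filter_upwards [hIs] using hd₀ w) (by filter_upwards [hIs] using hd w 1)
    (by filter_upwards [hIs] using hd w 2) (hd w 3 s (hJI hs))
    (by filter_upwards [hIs] using hd₀ _) (by filter_upwards [hIs] using hd _ 1)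
    (by filter_upwards [hIs] using hd _ 2) (hd _ 3 s (hJI hs))
    (by simp [planeDet]) (by simp [planeDet]) (by simp only [planeDet]; ring) (hw s hs).ne' hcurv
    hY hu.ne' ?_
  intro δ hδ
  obtain ⟨p, hp, q, hq, ε, hε, -, -, hBp, hBq, hcol⟩ :=
    hγ.exists_tangents_near hI hJI hJo hJ hw hσ hdual hs ht hst hU hA hδ
  refine ⟨p, hp, q, hq, ?_, ?_⟩
  · -- The value at `r` of `W = ε * V` says that the tangent line at `γ r` passes through the point
    -- `γ s - ε • (γ t - γ s)`.
    have hW : ∀ r, planeDet (deriv γ r) (γ s - ε • (γ t - γ s) - γ r) = 0 →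
        planeDet w (γ r - γ s) * planeDet (deriv γ s) (deriv γ r) -
          planeDet w (deriv γ r) * planeDet (deriv γ s) (γ r - γ s) =
        ε * (planeDet w (deriv γ r) * planeDet (deriv γ s) (γ t - γ s) -
          planeDet (deriv γ s) (deriv γ r) * planeDet w (γ t - γ s)) := by
      intro r hr
      have e := planeDet_mul_sub w (deriv γ s) (deriv γ r) (γ s - ε • (γ t - γ s) - γ r)
      rw [hr, mul_zero] at e
      simp only [planeDet, PiLp.sub_apply, PiLp.smul_apply, smul_eq_mul] at e ⊢
      linear_combination e
    rw [hW p hBp, hW q hBq]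
    ring
  · have e := planeDet_mul_sub w (deriv γ s) (γ q - γ p) (tangentMeet γ s t - γ p)
    have hA₀ : planeDet (deriv γ s) (tangentMeet γ s t - γ s) = 0 := by
      rw [tangentMeet_sub_left]
      simp only [planeDet, PiLp.smul_apply, smul_eq_mul]
      ring
    rw [hcol, mul_zero] at e
    simp only [planeDet_sub_right] at e hA₀ ⊢
    linear_combination e - (planeDet w (γ q) - planeDet w (γ p)) * hA₀

end IsSmoothConvexArc

theorem theorem1 (γ : ℝ → Plane) (α β t₀ : ℝ) (ht₀ : t₀ ∈ Ioo α β)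
    (hγ : IsSmoothConvexArc γ (Ioo α β))
    (U : Set Plane) (hU : U ∈ 𝓝 (γ t₀))
    (hdual : DualityPreservesIncidence γ (Ioo α β) U) :
    ∃ C : Set Plane, IsConic C ∧ ∀ᶠ t in 𝓝 t₀, γ t ∈ C := by
  have hI : IsOpen (Ioo α β) := isOpen_Ioo
  obtain ⟨σ, hσ⟩ := hγ.exists_sign
  obtain ⟨w, δ, hδ, hJI, hw, hJU, hA⟩ := hγ.exists_interval hI hσ ht₀ hU
  have hJ : (Ioo (t₀ - δ) (t₀ + δ)).OrdConnected := ordConnected_Ioo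
  -- The point of expansion lies strictly before `t₀`, so that a neighbourhood of `t₀` lies on one
  -- side of it and a single constant of integration suffices.
  obtain ⟨s, hs, hcurv⟩ := hγ.exists_planeDet_deriv_ne_zero hI hJI hJ hw hσ
    (a := t₀ - δ / 2) (b := t₀) ⟨by linarith, by linarith⟩ ⟨by linarith, by linarith⟩ (by linarith)
  have hsJ : s ∈ Ioo (t₀ - δ) (t₀ + δ) := ⟨by linarith [hs.1], by linarith [hs.2]⟩
  have htJ : ∀ t ∈ Ioo s (t₀ + δ), t ∈ Ioo (t₀ - δ) (t₀ + δ) :=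
    fun t ht => ⟨hsJ.1.trans ht.1, ht.2⟩
  have hd₀ : ∀ (v : Plane), ∀ t ∈ Ioo s (t₀ + δ), HasDerivAt (fun τ => planeDet v (γ τ - γ s))
      (planeDet v (deriv γ t)) t := fun v t ht =>
    ((hγ.hasDerivAt_iterate_deriv hI 0 (hJI (htJ t ht))).sub_const (γ s)).planeDet_right v
  have hY : ∀ t ∈ Ioo s (t₀ + δ), planeDet (deriv γ s) (γ t - γ s) ≠ 0 := fun t ht h => by
    simpa [h] using hσ s (hJI hsJ) t (hJI (htJ t ht)) ht.1.ne'
  have hcoord : ∀ t ∈ Ioo s (t₀ + δ), planeDet w (tangentMeet γ s t - γ s) =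
      (planeDet w (γ t - γ s) * planeDet (deriv γ s) (deriv γ t) -
        planeDet w (deriv γ t) * planeDet (deriv γ s) (γ t - γ s)) /
          planeDet (deriv γ s) (deriv γ t) := by
    intro t ht
    rw [planeDet_mul_sub, tangentMeet_sub_left]
    simp only [planeDet, PiLp.sub_apply, PiLp.smul_apply, smul_eq_mul]
    ring
  obtain ⟨k, hk⟩ := hγ.tangentMeet_relation hI hJI isOpen_Ioo hJ hw hσ hdual hsJ (hJU s hsJ) hcurv
  obtain ⟨e, he⟩ := exists_quadratic_relation (hd₀ w) (hd₀ (deriv γ s)) hY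
    (fun t ht h => by
      have := (hγ.tangentMeet_coord hI hJI hJ hw hσ hsJ (htJ t ht) ht.1).1
      rw [hcoord t ht, h, zero_div] at this
      exact this.false)
    (fun t ht => by
      have h := hk t (htJ t ht) ht.1 (hA s hsJ t (htJ t ht) ht.1)
      rwa [hcoord t ht] at h)
  refine ⟨_, isConic_of_quadratic (d₀ := planeDet w (γ s)) (d₁ := planeDet (deriv γ s) (γ s))
    (k := k) (e := e) (hw s hsJ).ne' hcurv (pow_ne_zero 2 (hw s hsJ).ne'), ?_⟩
  filter_upwards [Ioo_mem_nhds hs.2 (by linarith : t₀ < t₀ + δ)] with t ht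
  have h := he t ht
  simp only [planeDet_sub_right] at h
  exact h
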